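/- For graphs $F_1,\dots,F_r$, write $G\to(F_1,\dots,F_r)$ if every colouring of the edges of the graph $G$ with colours $1,\dots,r$ contains, for some $i$, a copy of $F_i$ (as a not necessarily induced subgraph) all of whose edges have colour $i$. The size Ramsey number is $$\hat r(F_1,\dots,F_r)=\min\{e(G)\mid G \text{ a finite graph},\ G\to(F_1,\dots,F_r)\},$$ where $e(G)$ is the number of edges of $G$. Let $K_{a,b}$ denote the complete bipartite graph with parts of sizes $a$ and $b$. Let $r\ge 2$ and let $s_2,\dots,s_r,t_2,\dots,t_r$ be positive integers with $t_i\ge s_i$ for all $2\le i\le r$ and with $s_i\ge 2$ for at least one $i$. Then, as $n\to\infty$ with $r$, the $s_i$ and the $t_i$ fixed, $$\hat r(K_{1,n},K_{s_2,t_2},\dots,K_{s_r,t_r})=4\Bigl(1-r+\sum_{i=2}^r s_i\Bigr)n+O(1).$$ That is, there is a constant $C$, depending only on $r$, the $s_i$ and the $t_i$, such that for every $n\ge1$ some finite graph arrows $(K_{1,n},K_{s_2,t_2},\dots,K_{s_r,t_r})$, and the two sides without the $O(1)$ term differ by at most $C$ in absolute value. -/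

import Mathlib

open SimpleGraph

/-- `G → (F i)_{i ∈ ι}`: for every colouring of the edges of `G` with colour set `ι` there is a
colour `i` such that the graph of all edges of colour `i` contains a copy of `F i` as a (not
necessarily induced) subgraph. -/
def GraphArrows {V ι : Type*} {W : ι → Type*} (G : SimpleGraph V)
    (F : (i : ι) → SimpleGraph (W i)) : Prop :=
  ∀ c : EdgeLabeling G ι, ∃ i : ι, (F i).IsContained (c.labelGraph i)

/-- The set of all values `e(G)`, where `G` is a finite graph that arrows the family `F`. -/
def arrowingSizes {ι : Type*} {W : ι → Type*} (F : (i : ι) → SimpleGraph (W i)) : Set ℕ :=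
  {m | ∃ (N : ℕ) (G : SimpleGraph (Fin N)), GraphArrows G F ∧ G.edgeSet.ncard = m}

/-- The size Ramsey number of the family `F`: the minimum number of edges of a graph arrowing
`F` (the minimum is meaningful when `arrowingSizes F` is nonempty). -/
noncomputable def sizeRamsey {ι : Type*} {W : ι → Type*}
    (F : (i : ι) → SimpleGraph (W i)) : ℕ :=
  sInf (arrowingSizes F)

/-- The family of complete bipartite graphs `K_{a i, b i}`. -/
def bicliqueFamily {ι : Type*} (a b : ι → ℕ) (i : ι) : SimpleGraph (Fin (a i) ⊕ Fin (b i)) :=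
  completeBipartiteGraph (Fin (a i)) (Fin (b i))

/-- The family `K_{1,n}, K_{s 0, t 0}, …, K_{s (k-1), t (k-1)}` of `k + 1` graphs. -/
def starBicliqueFamily {k : ℕ} (n : ℕ) (s t : Fin k → ℕ) :=
  bicliqueFamily (Fin.cons 1 s : Fin (k + 1) → ℕ) (Fin.cons n t : Fin (k + 1) → ℕ)

/-! Put σ = ∑ (s i - 1), which is the coefficient 1 - r + ∑ s i. Upper bound: in K_{2σ,N} with N =
2n + O(1), a vertex of the large side with more than σ non-red edges (red is colour 0) has at least
s i edges of some colour i + 1. Without a coloured biclique only O(1) such vertices exist, so about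
half of all edges are red and some vertex of the small side has n red edges. Lower bound: let A be
the O(1) vertices of degree at least n. If G has at most 4σ(n - #A) edges, Hall's theorem
(`exists_edge_assignment`) splits the edges leaving A so that few stay red at each vertex of A and
each outside vertex gets at most s i - 1 edges of colour i + 1. Hall's condition reduces to AM-GM
(`card_le_capacity`). -/

open Finset in
theorem graphArrows_starBicliqueFamily_iff {V : Type*} {G : SimpleGraph V} {k n : ℕ}
    {s t : Fin k → ℕ} :
    GraphArrows G (starBicliqueFamily n s t) ↔ ∀ c : EdgeLabeling G (Fin (k + 1)),
      (∃ L R : Finset V, #L = 1 ∧ #R = n ∧ (c.labelGraph 0).IsCompleteBetween L R) ∨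
      ∃ i : Fin k, ∃ L R : Finset V, #L = s i ∧ #R = t i ∧
        (c.labelGraph i.succ).IsCompleteBetween L R := by
  unfold GraphArrows starBicliqueFamily bicliqueFamily
  refine forall_congr' fun c => ?_
  simp only [completeBipartiteGraph_isContained_iff, Fintype.card_fin]
  rw [Fin.exists_fin_succ]
  simp only [Fin.cons_zero, Fin.cons_succ]

theorem GraphArrows.of_hom {V V' ι : Type*} {W : ι → Type*} {G : SimpleGraph V}
    {G' : SimpleGraph V'} {F : (i : ι) → SimpleGraph (W i)} (h : GraphArrows G F)
    (f : G →g G') (hf : Function.Injective f) : GraphArrows G' F := by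
  intro c
  obtain ⟨i, hi⟩ := h (c.pullback f)
  refine ⟨i, hi.trans ⟨⟨⟨f, fun {x y} hxy => ?_⟩, hf⟩⟩⟩
  rw [EdgeLabeling.labelGraph_adj] at hxy ⊢
  obtain ⟨H, hc⟩ := hxy
  exact ⟨f.map_adj H, hc⟩

theorem GraphArrows.ncard_mem_arrowingSizes {V ι : Type*} [Finite V] {W : ι → Type*}
    {G : SimpleGraph V} {F : (i : ι) → SimpleGraph (W i)} (h : GraphArrows G F) :
    G.edgeSet.ncard ∈ arrowingSizes F := by
  obtain ⟨N, ⟨e⟩⟩ := Finite.exists_equiv_fin V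
  let φ : G ≃g G.map e.toEmbedding := Iso.map e G
  refine ⟨N, G.map e.toEmbedding, h.of_hom φ.toHom φ.injective, ?_⟩
  rw [← Nat.card_coe_set_eq, ← Nat.card_coe_set_eq]
  exact Nat.card_congr φ.mapEdgeSet.symm

/-! ### Upper bound: colourings of an unbalanced complete bipartite graph -/

open Finset in
/-- Pigeonhole: either there is a monochromatic rectangle, or few columns contain the colour
`j` at least `p` times. -/
theorem card_columns_le_or_exists_rectangle {α β κ : Type*} [Fintype α] [Fintype β]
    [DecidableEq κ] (c : α → β → κ) (j : κ) (p q : ℕ) :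
    #{y | p ≤ #{x | c x y = j}} ≤ q * (Fintype.card α).choose p ∨
      ∃ (L : Finset α) (R : Finset β), #L = p ∧ #R = q ∧ ∀ x ∈ L, ∀ y ∈ R, c x y = j := by
  classical
  by_contra! h
  obtain ⟨h₁, h₂⟩ := h
  have hsub : ∀ y : β, ∃ S : Finset α, p ≤ #{x | c x y = j} → #S = p ∧ ∀ x ∈ S, c x y = j := by
    intro y
    by_cases hy : p ≤ #{x | c x y = j}
    · obtain ⟨S, hS, hp⟩ := exists_subset_card_eq hy
      exact ⟨S, fun _ => ⟨hp, fun x hx => by simpa using hS hx⟩⟩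
    · exact ⟨∅, fun h => absurd h hy⟩
  choose f hf using hsub
  have hmaps : ∀ y ∈ ({y | p ≤ #{x | c x y = j}} : Finset β),
      f y ∈ powersetCard p (univ : Finset α) := fun y hy =>
    mem_powersetCard.2 ⟨subset_univ _, (hf y (by simpa using hy)).1⟩
  obtain ⟨L, hL, hlt⟩ := exists_lt_card_fiber_of_mul_lt_card_of_maps_to (n := q) hmaps (by
    rw [card_powersetCard, card_univ, mul_comm]; exact h₁)
  obtain ⟨R, hR, hq⟩ := exists_subset_card_eq hlt.le
  obtain ⟨x, hx, y, hy, hne⟩ := h₂ L R (mem_powersetCard.1 hL).2 hq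
  have hy' := hR hy
  simp only [mem_filter, mem_univ, true_and] at hy'
  exact hne ((hf y hy'.1).2 x (hy'.2 ▸ hx))

-- Double counting of the red cells. The additive term in N exactly pays for the bad columns, each
-- of which is crudely allowed to be entirely non-red.
open Finset in
theorem exists_star_or_rectangle {k n σ N : ℕ} {s t : Fin k → ℕ} (hs : ∀ i, 1 ≤ s i)
    (hσ : ∑ i, (s i - 1) = σ) (hpos : 1 ≤ σ) (hn : 1 ≤ n)
    (hN : N = 2 * n + 2 * ∑ i, t i * (2 * σ).choose (s i))
    (c : Fin (2 * σ) → Fin N → Fin (k + 1)) :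
    (∃ x, n ≤ #{y | c x y = 0}) ∨ ∃ i, ∃ (L : Finset (Fin (2 * σ))) (R : Finset (Fin N)),
      #L = s i ∧ #R = t i ∧ ∀ x ∈ L, ∀ y ∈ R, c x y = i.succ := by
  by_contra! h
  obtain ⟨h₁, h₂⟩ := h
  have hbad : ∀ i : Fin k, #{y | s i ≤ #{x | c x y = i.succ}} ≤ t i * (2 * σ).choose (s i) := by
    intro i
    rcases card_columns_le_or_exists_rectangle c i.succ (s i) (t i) with h | ⟨L, R, hL, hR, h⟩
    · simpa using h
    · obtain ⟨x, hx, y, hy, hne⟩ := h₂ i L R hL hR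
      exact absurd (h x hx y hy) hne
  have hcol : ∀ y i, #{x | c x y = i.succ} ≤
      (s i - 1) + 2 * σ * (if s i ≤ #{x | c x y = i.succ} then 1 else 0) := by
    intro y i
    split_ifs with hy
    · exact (card_le_univ _).trans (by simp)
    · have := hs i
      omega
  have hnonred : ∑ y : Fin N, ∑ i : Fin k, #{x | c x y = i.succ} ≤
      N * σ + 2 * σ * ∑ i, t i * (2 * σ).choose (s i) := by
    calc _ ≤ ∑ y : Fin N, ∑ i : Fin k,
          ((s i - 1) + 2 * σ * (if s i ≤ #{x | c x y = i.succ} then 1 else 0)) :=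
          sum_le_sum fun y _ => sum_le_sum fun i _ => hcol y i
      _ = N * σ + 2 * σ * ∑ i, #{y | s i ≤ #{x | c x y = i.succ}} := by
          simp only [sum_add_distrib, hσ, ← mul_sum]
          rw [sum_comm, sum_const, card_univ, Fintype.card_fin, smul_eq_mul]
          simp only [card_filter]
      _ ≤ _ := by gcongr with i; exact hbad i
  have hred : ∑ y : Fin N, #{x | c x y = 0} ≤ 2 * σ * (n - 1) := by
    have : ∑ y : Fin N, #{x | c x y = 0} = ∑ x : Fin (2 * σ), #{y | c x y = 0} := by
      simp only [card_filter]
      exact sum_comm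
    rw [this]
    calc _ ≤ ∑ _x : Fin (2 * σ), (n - 1) := sum_le_sum fun x _ => Nat.le_sub_one_of_lt (h₁ x)
      _ = _ := by simp
  have htot : ∑ y : Fin N, #{x | c x y = 0} + ∑ y : Fin N, ∑ i : Fin k, #{x | c x y = i.succ}
      = N * (2 * σ) := by
    rw [← sum_add_distrib]
    have : ∀ y : Fin N, #{x | c x y = 0} + ∑ i : Fin k, #{x | c x y = i.succ} = 2 * σ := by
      intro y
      have := card_eq_sum_card_fiberwise (s := (univ : Finset (Fin (2 * σ))))
        (t := (univ : Finset (Fin (k + 1)))) (f := fun x => c x y) (fun _ _ => mem_coe.2 (mem_univ _))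
      rw [Fin.sum_univ_succ, card_univ, Fintype.card_fin] at this
      exact this.symm
    simp [this]
  obtain ⟨m, rfl⟩ : ∃ m, n = m + 1 := ⟨n - 1, by omega⟩
  simp only [Nat.add_sub_cancel] at hred
  nlinarith

open Finset in
theorem graphArrows_completeBipartiteGraph {k n σ N : ℕ} {s t : Fin k → ℕ} (hs : ∀ i, 1 ≤ s i)
    (hσ : ∑ i, (s i - 1) = σ) (hpos : 1 ≤ σ) (hn : 1 ≤ n)
    (hN : N = 2 * n + 2 * ∑ i, t i * (2 * σ).choose (s i)) :
    GraphArrows (completeBipartiteGraph (Fin (2 * σ)) (Fin N)) (starBicliqueFamily n s t) := by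
  rw [graphArrows_starBicliqueFamily_iff]
  intro c
  have hadj : ∀ x y, (completeBipartiteGraph (Fin (2 * σ)) (Fin N)).Adj (.inl x) (.inr y) := by
    simp
  rcases exists_star_or_rectangle hs hσ hpos hn hN (fun x y => c ⟨s(.inl x, .inr y), hadj x y⟩) with
    ⟨x, hx⟩ | ⟨i, L, R, hL, hR, h⟩
  · obtain ⟨R, hR, hRn⟩ := exists_subset_card_eq hx
    refine .inl ⟨{.inl x}, R.map .inr, by simp, by simpa using hRn, ?_⟩
    rintro _ hv _ hw
    simp only [coe_singleton, Set.mem_singleton_iff, coe_map, Set.mem_image, mem_coe] at hv hw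
    obtain ⟨y, hy, rfl⟩ := hw
    subst hv
    exact (EdgeLabeling.labelGraph_adj _ _).2 ⟨hadj x y, by simpa using hR hy⟩
  · refine .inr ⟨i, L.map .inl, R.map .inr, by simpa using hL, by simpa using hR, ?_⟩
    rintro _ hv _ hw
    simp only [coe_map, Set.mem_image, mem_coe] at hv hw
    obtain ⟨x, hx, rfl⟩ := hv
    obtain ⟨y, hy, rfl⟩ := hw
    exact (EdgeLabeling.labelGraph_adj _ _).2 ⟨hadj x y, h x hx y hy⟩

/-! ### Lower bound: a colouring built from Hall's theorem -/

/-- If `F` is a set of edges between `S` and `T`, contained in a set of at most `4σd` edges, then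
`F` does not exceed the capacity `d` per vertex of `S` plus `σ` per vertex of `T`. -/
theorem card_le_capacity {σ d m x y f : ℕ} (hfm : f ≤ m) (hf : f ≤ x * y)
    (hm : m ≤ 4 * σ * d) : f ≤ x * d + y * σ := by
  rcases le_or_gt x σ with h | h
  · nlinarith
  · obtain ⟨z, rfl⟩ := Nat.exists_eq_add_of_lt h
    -- AM-GM with z + 1 = x - σ. Then x * f = σ * f + (x - σ) * f, where the first term is bounded
    -- by f ≤ x * y and the second by f ≤ 4 * σ * d.
    have hsq : 4 * σ * (z + 1) ≤ (σ + z + 1) * (σ + z + 1) := by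
      zify
      nlinarith [sq_nonneg ((σ : ℤ) - (z + 1))]
    have hcap : f * (z + 1) ≤ (σ + z + 1) * (σ + z + 1) * d := by
      calc f * (z + 1) ≤ 4 * σ * d * (z + 1) := Nat.mul_le_mul_right _ (hfm.trans hm)
        _ = 4 * σ * (z + 1) * d := by ring
        _ ≤ _ := Nat.mul_le_mul_right _ hsq
    have : (σ + z + 1) * f ≤ (σ + z + 1) * ((σ + z + 1) * d + y * σ) := by
      nlinarith
    exact Nat.le_of_mul_le_mul_left this (by omega)

open Finset in
/-- Hall's theorem assigns every edge between `A` and its complement to one of its ends, so that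
every vertex of `A` receives at most `d` edges and every other vertex at most `#Q` edges. -/
theorem exists_edge_assignment {V Q : Type*} [Fintype V] [Fintype Q] (G : SimpleGraph V)
    (A : Finset V) (d : ℕ) (hm : G.edgeSet.ncard ≤ 4 * Fintype.card Q * d) :
    ∃ f : {p : V × V // p.1 ∈ A ∧ p.2 ∉ A ∧ G.Adj p.1 p.2} → (V × Fin d) ⊕ (V × Q),
      Function.Injective f ∧
      ∀ p, (∃ j, f p = .inl (p.1.1, j)) ∨ ∃ q, f p = .inr (p.1.2, q) := by
  classical
  obtain ⟨f, hf, hmem⟩ := (Finset.all_card_le_biUnion_card_iff_exists_injective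
    (fun p : {p : V × V // p.1 ∈ A ∧ p.2 ∉ A ∧ G.Adj p.1 p.2} =>
      (({p.1.1} : Finset V) ×ˢ (univ : Finset (Fin d))).disjSum
        (({p.1.2} : Finset V) ×ˢ (univ : Finset Q)))).1 (by
    intro F
    set S := F.image fun p => p.1.1 with hS
    set T := F.image fun p => p.1.2 with hT
    have hsub : (S ×ˢ (univ : Finset (Fin d))).disjSum (T ×ˢ (univ : Finset Q)) ⊆
        F.biUnion fun p => (({p.1.1} : Finset V) ×ˢ (univ : Finset (Fin d))).disjSum
          (({p.1.2} : Finset V) ×ˢ (univ : Finset Q)) := by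
      intro z hz
      simp only [mem_biUnion]
      rcases z with ⟨v, j⟩ | ⟨v, q⟩
      · have hv : v ∈ S := by simpa using hz
        obtain ⟨p, hp, rfl⟩ := mem_image.1 hv
        exact ⟨p, hp, by simp⟩
      · have hv : v ∈ T := by simpa using hz
        obtain ⟨p, hp, rfl⟩ := mem_image.1 hv
        exact ⟨p, hp, by simp⟩
    refine le_trans ?_ (card_le_card hsub)
    rw [card_disjSum, card_product, card_product, card_univ, card_univ, Fintype.card_fin]
    refine card_le_capacity ?_ ?_ hm
    · rw [← Set.ncard_coe_finset]
      refine Set.ncard_le_ncard_of_injOn (fun p => s(p.1.1, p.1.2)) (fun p _ => p.2.2.2) ?_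
        (Set.toFinite _)
      rintro ⟨⟨a, b⟩, ha, hb, hab⟩ - ⟨⟨a', b'⟩, ha', hb', hab'⟩ - h
      rcases Sym2.eq_iff.1 h with ⟨h₁, h₂⟩ | ⟨h₁, h₂⟩
      · simp only at h₁ h₂
        simp [h₁, h₂]
      · simp only at h₁ h₂ ha hb'
        exact absurd (h₁ ▸ ha) hb'
    · rw [← card_product, ← card_map (Function.Embedding.subtype _)]
      refine card_le_card fun p hp => ?_
      simp only [mem_map] at hp
      obtain ⟨p', hp', rfl⟩ := hp
      exact mem_product.2 ⟨mem_image_of_mem _ hp', mem_image_of_mem _ hp'⟩)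
  refine ⟨f, hf, fun p => ?_⟩
  have := hmem p
  rw [mem_disjSum] at this
  rcases this with ⟨⟨v, j⟩, hv, h⟩ | ⟨⟨v, q⟩, hv, h⟩
  · have : p.1.1 = v := by simpa using hv
    exact .inl ⟨j, by rw [← h, this]⟩
  · have : p.1.2 = v := by simpa using hv
    exact .inr ⟨q, by rw [← h, this]⟩

-- Edges assigned to their end outside A take the colour of their slot; all others are red. A vertex
-- of A has red degree at most (#A - 1) + (n - #A) < n. Non-red edges always leave A, so a coloured
-- biclique would have a vertex outside A, whose degree in that colour is below s i ≤ t i.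
open Finset in
theorem not_graphArrows_of_le {V : Type*} [Fintype V] {G : SimpleGraph V} {k n : ℕ}
    {s t : Fin k → ℕ} (hs : ∀ i, 1 ≤ s i) (hst : ∀ i, s i ≤ t i) (A : Finset V)
    (hA : ∀ v ∉ A, ∀ R : Finset V, (∀ w ∈ R, G.Adj v w) → #R < n)
    (hAn : #A ≤ n)
    (hm : G.edgeSet.ncard ≤ 4 * (∑ i, (s i - 1)) * (n - #A)) :
    ¬ GraphArrows G (starBicliqueFamily n s t) := by
  classical
  obtain ⟨f, hf, hfp⟩ := exists_edge_assignment (Q := Σ i : Fin k, Fin (s i - 1)) G A (n - #A)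
    (by simpa using hm)
  rw [graphArrows_starBicliqueFamily_iff]
  -- The edge e occupies a slot of colour i at its end outside A.
  let P (e : Sym2 V) (i : Fin k) : Prop :=
    ∃ (p : _) (q : _), s(p.1.1, p.1.2) = e ∧ f p = .inr (p.1.2, ⟨i, q⟩)
  let c : EdgeLabeling G (Fin (k + 1)) := fun e =>
    if h : ∃ i, P e.1 i then h.choose.succ else 0
  have hc0 : ∀ v w, (c.labelGraph 0).Adj v w → G.Adj v w ∧ ∀ i, ¬ P s(v, w) i := by
    intro v w h
    obtain ⟨H, h⟩ := (EdgeLabeling.labelGraph_adj _ _).1 h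
    refine ⟨H, fun i hi => ?_⟩
    have hex : ∃ i, P s(v, w) i := ⟨i, hi⟩
    simp only [c, dif_pos hex] at h
    exact Fin.succ_ne_zero _ h
  have hcs : ∀ i v w, (c.labelGraph (Fin.succ i)).Adj v w → P s(v, w) i := by
    intro i v w h
    obtain ⟨H, h⟩ := (EdgeLabeling.labelGraph_adj _ _).1 h
    by_cases hex : ∃ i, P s(v, w) i
    · simp only [c, dif_pos hex] at h
      rw [← Fin.succ_injective _ h]
      exact hex.choose_spec
    · simp only [c, dif_neg hex] at h
      exact absurd h.symm (Fin.succ_ne_zero _)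
  have hlow : ∀ i, ∀ b ∉ A, ∀ R : Finset V, (∀ w ∈ R, (c.labelGraph (Fin.succ i)).Adj b w) →
      #R ≤ s i - 1 := by
    intro i b hb R hR
    have hex : ∀ w : R, ∃ (h : _) (q : _), f ⟨(w.1, b), h⟩ = .inr (b, ⟨i, q⟩) := by
      rintro ⟨w, hw⟩
      obtain ⟨p, q, he, hp⟩ := hcs i b w (hR w hw)
      rcases Sym2.eq_iff.1 he with ⟨h₁, h₂⟩ | ⟨h₁, h₂⟩
      · exact absurd (h₁ ▸ p.2.1) hb
      · have : p.1 = (w, b) := Prod.ext h₁ h₂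
        obtain ⟨p, hp'⟩ := p
        subst this
        exact ⟨hp', q, hp⟩
    choose g q hq using hex
    have hinj : Function.Injective q := by
      intro w w' h
      have := hf ((hq w).trans (h ▸ (hq w').symm))
      simp only [Subtype.mk.injEq, Prod.mk.injEq] at this
      exact Subtype.ext this.1
    simpa using Fintype.card_le_of_injective _ hinj
  intro h
  rcases h c with ⟨L, R, hL, hR, h⟩ | ⟨i, L, R, hL, hR, h⟩
  · obtain ⟨v, rfl⟩ := card_eq_one.1 hL
    have hadj : ∀ w ∈ R, (c.labelGraph 0).Adj v w := fun w hw => h (by simp) hw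
    by_cases hv : v ∈ A
    · have h₁ : #(R.filter (· ∈ A)) ≤ #A - 1 := by
        rw [← card_erase_of_mem hv]
        refine card_le_card fun w hw => ?_
        rw [mem_filter] at hw
        exact mem_erase.2 ⟨(hadj w hw.1).ne', hw.2⟩
      have hex : ∀ w : R.filter (· ∉ A), ∃ (h : _) (j : _), f ⟨(v, w.1), h⟩ = .inl (v, j) := by
        rintro ⟨w, hw⟩
        rw [mem_filter] at hw
        obtain ⟨hvw, hP⟩ := hc0 v w (hadj w hw.1)
        refine ⟨⟨hv, hw.2, hvw⟩, ?_⟩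
        rcases hfp ⟨(v, w), hv, hw.2, hvw⟩ with h | ⟨⟨i, q⟩, h⟩
        · exact h
        · exact absurd ⟨_, q, rfl, h⟩ (hP i)
      choose g j hj using hex
      have hinj : Function.Injective j := by
        intro w w' h
        have := hf ((hj w).trans (h ▸ (hj w').symm))
        simp only [Subtype.mk.injEq, Prod.mk.injEq] at this
        exact Subtype.ext this.2
      have h₂ : #(R.filter (· ∉ A)) ≤ n - #A := by
        simpa only [Fintype.card_coe, Fintype.card_fin] using Fintype.card_le_of_injective _ hinj
      have h₃ := card_filter_add_card_filter_not (s := R) (· ∈ A)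
      have h₄ : 1 ≤ #A := card_pos.2 ⟨v, hv⟩
      omega
    · exact (hA v hv R fun w hw => (hc0 v w (hadj w hw)).1).ne hR
  · have hsi := hs i
    have hti := hst i
    obtain ⟨a, ha⟩ : L.Nonempty := card_pos.1 (by omega)
    obtain ⟨b, hb⟩ : R.Nonempty := card_pos.1 (by omega)
    have haA : a ∈ A := by
      by_contra haA
      have := hlow i a haA R fun w hw => h ha hw
      omega
    have hbA : b ∈ A := by
      by_contra hbA
      have := hlow i b hbA L fun w hw => (h hw hb).symm
      omega
    obtain ⟨p, q, he, -⟩ := hcs i a b (h ha hb)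
    rcases Sym2.eq_iff.1 he with ⟨h₁, h₂⟩ | ⟨h₁, h₂⟩
    · exact p.2.2.1 (h₂ ▸ hbA)
    · exact p.2.2.1 (h₂ ▸ haA)

open Finset in
theorem lt_of_mem_arrowingSizes {k n m : ℕ} {s t : Fin k → ℕ} (hs : ∀ i, 1 ≤ s i)
    (hst : ∀ i, s i ≤ t i) (hpos : 1 ≤ ∑ i, (s i - 1)) (hn : 1 ≤ n)
    (hm : m ∈ arrowingSizes (starBicliqueFamily n s t)) :
    4 * (∑ i, (s i - 1)) * n < m + 32 * (∑ i, (s i - 1)) ^ 2 := by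
  classical
  obtain ⟨N, G, hG, rfl⟩ := hm
  by_contra! hle
  set σ := ∑ i, (s i - 1) with hσ
  let A : Finset (Fin N) := {v | n ≤ G.degree v}
  have hedge : G.edgeSet.ncard = #G.edgeFinset := by
    rw [← coe_edgeFinset, Set.ncard_coe_finset]
  have hdeg : #A * n ≤ 2 * G.edgeSet.ncard := by
    rw [hedge, ← G.sum_degrees_eq_twice_card_edges, ← smul_eq_mul]
    exact (card_nsmul_le_sum A _ n fun v hv => (mem_filter.1 hv).2).trans
      (sum_le_sum_of_subset (subset_univ A))
  have hA : #A ≤ 8 * σ := by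
    -- By `hle` there are at most 4σn edges, so the degree sum is at most 8σn.
    refine Nat.le_of_mul_le_mul_right (c := n) ?_ hn
    nlinarith
  have hn8 : 8 * σ ≤ n := by nlinarith
  refine not_graphArrows_of_le hs hst A ?_ (hA.trans hn8) ?_ hG
  · intro v hv R hR
    have : ¬ n ≤ G.degree v := fun h => hv (by simpa [A] using h)
    refine lt_of_le_of_lt ?_ (not_le.1 this)
    rw [← G.card_neighborFinset_eq_degree]
    exact card_le_card fun w hw => (G.mem_neighborFinset v w).2 (hR w hw)
  -- Replacing n by n - #A costs at most 4σ · 8σ = 32σ² edges.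
  · obtain ⟨d, hd⟩ := Nat.exists_eq_add_of_le (hA.trans hn8)
    rw [hd, Nat.add_sub_cancel_left]
    nlinarith

theorem mainTheorem5 (k : ℕ) (s t : Fin k → ℕ) (hs : ∀ i, 1 ≤ s i) (hst : ∀ i, s i ≤ t i)
    (hne : ∃ i, 2 ≤ s i) :
    ∃ C : ℝ, ∀ n : ℕ, 1 ≤ n →
      (arrowingSizes (starBicliqueFamily n s t)).Nonempty ∧
      |(sizeRamsey (starBicliqueFamily n s t) : ℝ)
        - 4 * (1 - ((k + 1 : ℕ) : ℝ) + ∑ i, (s i : ℝ)) * (n : ℝ)| ≤ C := by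
  obtain ⟨σ, hσ⟩ : ∃ σ, ∑ i, (s i - 1) = σ := ⟨_, rfl⟩
  have hpos : 1 ≤ σ := by
    obtain ⟨i, hi⟩ := hne
    rw [← hσ]
    exact le_trans (by omega) (Finset.single_le_sum (f := fun i => s i - 1)
      (fun _ _ => Nat.zero_le _) (Finset.mem_univ i))
  have hcast : (1 - ((k + 1 : ℕ) : ℝ) + ∑ i, (s i : ℝ)) = σ := by
    rw [← hσ, Nat.cast_sum]
    simp only [Nat.cast_sub (hs _), Nat.cast_one, Finset.sum_sub_distrib]
    simp
    ring
  set B := ∑ i, t i * (2 * σ).choose (s i) with hB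
  refine ⟨32 * σ ^ 2 + 4 * σ * B, fun n hn => ?_⟩
  have hmem : 2 * σ * (2 * n + 2 * B) ∈ arrowingSizes (starBicliqueFamily n s t) := by
    have h := (graphArrows_completeBipartiteGraph (t := t) hs hσ hpos hn rfl).ncard_mem_arrowingSizes
    rwa [Set.ncard, encard_edgeSet_completeBipartiteGraph, ← ENat.card_prod,
      ENat.card_eq_coe_natCard, ENat.toNat_natCast, Nat.card_prod, Nat.card_fin, Nat.card_fin] at h
  refine ⟨⟨_, hmem⟩, ?_⟩
  have hupper : sizeRamsey (starBicliqueFamily n s t) ≤ 2 * σ * (2 * n + 2 * B) :=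
    Nat.sInf_le hmem
  have hlower := lt_of_mem_arrowingSizes hs hst (hσ ▸ hpos) hn (Nat.sInf_mem ⟨_, hmem⟩)
  rw [hσ] at hlower
  change _ < sizeRamsey _ + _ at hlower
  generalize sizeRamsey (starBicliqueFamily n s t) = m at hupper hlower
  have hupper' : (m : ℝ) ≤ 2 * σ * (2 * n + 2 * B) := by exact_mod_cast hupper
  have hlower' : (4 * σ * n : ℝ) < m + 32 * σ ^ 2 := by exact_mod_cast hlower
  have h₁ : (0 : ℝ) ≤ 32 * σ ^ 2 := by positivity
  have h₂ : (0 : ℝ) ≤ 4 * σ * B := by positivity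
  rw [hcast, abs_le]
  constructor <;> linarith
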